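/- Let $p$ be a prime and let $G$ be a group of nilpotency class at most $2$ and of exponent $p$ (meaning $g^p=1$ for all $g\in G$; the trivial group is allowed). Write $Z(G)$ for the centre of $G$ and $[G,G]$ for its commutator subgroup; under these hypotheses both $[G,G]$ and $G/Z(G)$ are elementary abelian $p$-groups, and the rank of such a group is its dimension as a vector space over $\mathbb{F}_p$. A group $H$ with $H/Z(H)\cong G$ is called a witness to the capability of $G$, and $G$ is called capable if such a group $H$ exists. For a group $H$ let $H_1=H$, $H_{i+1}=[H_i,H]$ be the terms of its lower central series, so that $H_3=[[H,H],H]$. Suppose that $G$ is capable and that $[G,G]$ has finite rank $k$. Then $G/Z(G)$ has finite rank at most $2k+\binom{k}{2}$. Moreover, if the rank of $G/Z(G)$ is equal to $2k+\binom{k}{2}$, then there exists a witness $H$ to the capability of $G$ such that $H_3$ is cyclic (possibly trivial). (It is not assumed that $Z(G)=[G,G]$.) -/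

import Mathlib

universe u

/-- `H` is a witness to the capability of `G`: `G` is isomorphic to the central quotient of `H`. -/
def IsCapabilityWitness (G H : Type*) [Group G] [Group H] : Prop :=
  Nonempty ((H ⧸ Subgroup.center H) ≃* G)

/-- `G` is capable: it is the central quotient of some group. The witness may be taken in the
universe of `G`, since the subgroup of a witness generated by lifts of the elements of `G` is, up to isomorphism, such
a witness. -/
def IsCapable (G : Type u) [Group G] : Prop :=
  ∃ (H : Type u) (_ : Group H), IsCapabilityWitness G H

/-- `A` is an elementary abelian `p`-group of rank `r`: it is isomorphic to the additive group of
the vector space of dimension `r` over the field with `p` elements. -/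
def IsElementaryAbelianOfRank (p : ℕ) (A : Type*) [Group A] (r : ℕ) : Prop :=
  Nonempty (A ≃* Multiplicative (Fin r → ZMod p))

/-- The term `H_n` (for `n ≥ 1`) of the lower central series of `H`, with the indexing
`H_1 = H` and `H_{n+1} = [H_n, H]`. -/
def lowerCentralTerm (H : Type*) [Group H] (n : ℕ) : Subgroup H :=
  Subgroup.lowerCentralSeries (⊤ : Subgroup H) (n - 1)

/-! Put V = G/Z(G) and W = [G,G]; the commutator induces an alternating bracket b : V × V → W with
trivial radical. If H is a witness, then H_3 is central of exponent p, and each character φ of H_3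
yields an action T : W → V*, T(w)(v) = φ([w,v]), computed on lifts to H. The Hall–Witt identity
makes T a Jacobi action. The actions jointly separate W, since a lift of a nontrivial w to [H,H] is
not central in H.

The rank bound is then linear algebra. If v is killed by the image of T, Jacobi makes (u,u') ↦
T(b(v,u))(u') symmetric, so few linear conditions force it to vanish (`rank_bracketPreimage_le`).
Iterating over the actions shrinks the allowed values of b(v,·) to 0, and hence v to 0. Starting
from a T of maximal rank gives the bound with dim ker T to spare, so equality forces T to be
injective (`rank_le_of_separating_isJacobi`).

In that case one φ detects W, and H/ker φ has cyclic third term. Its centre may be too large because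
Z(G) may exceed [G,G]; a central extension by a bilinear cocycle repairs this without enlarging the
third term (`exists_witness_isCyclic`). -/

open scoped commutatorElement

/-! ### Linear algebra: dimension count for brackets with Jacobi actions -/

section LinearAlgebra

variable {F V W : Type*} [Field F] [AddCommGroup V] [Module F V] [AddCommGroup W] [Module F W]

/-- A linear map to a coordinate space of dimension `n` raises the rank of the kernel by at most
`n`. -/
theorem rank_le_of_rank_ker_le {ι : Type*} [Fintype ι] (f : V →ₗ[F] ι → F) {m : ℕ}
    (h : Module.rank F (LinearMap.ker f) ≤ m) :
    Module.rank F V ≤ ((m + Fintype.card ι : ℕ) : Cardinal) := by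
  have h1 := LinearMap.lift_rank_range_add_rank_ker f
  have h2 : Module.rank F (LinearMap.range f) ≤ (Fintype.card ι : Cardinal) := by
    have := Submodule.rank_le (LinearMap.range f)
    rwa [rank_fun'] at this
  refine Cardinal.lift_le_nat_iff.1 (h1.symm.le.trans ?_)
  rw [Nat.cast_add, add_comm (m : Cardinal)]
  exact add_le_add (Cardinal.lift_le_nat_iff.2 h2) (Cardinal.lift_le_nat_iff.2 h)

/-- A `d`-dimensional space of linear forms is separated by `d` vectors. -/
theorem exists_separating_family (D : Submodule F (Module.Dual F V)) [FiniteDimensional F D] :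
    ∃ x : Fin (Module.finrank F D) → V, ∀ e ∈ D, (∀ i, e (x i) = 0) → e = 0 := by
  have : Module.Free F D := Module.Free.of_divisionRing F D
  -- Since `D` is finite-dimensional, every functional on it is evaluation at a vector of `V`; the
  -- `x i` realize the coordinate functionals of a basis.
  have hs : Function.Surjective (Submodule.quotDualCoannihilatorToDual D) :=
    (Subspace.quotDualCoannihilatorToDual_bijective D).2
  have key : ∀ φ : Module.Dual F D, ∃ x : V, ∀ e : D, (e : Module.Dual F V) x = φ e := by
    intro φ
    obtain ⟨q, hq⟩ := hs φ
    obtain ⟨x, rfl⟩ := Submodule.Quotient.mk_surjective _ q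
    exact ⟨x, fun e => by rw [← hq]; rfl⟩
  choose x hx using fun i => key ((Module.finBasis F D).coord i)
  refine ⟨x, fun e he h => ?_⟩
  have : (⟨e, he⟩ : D) = 0 := by
    apply (Module.finBasis F D).ext_elem
    intro i
    have := hx i ⟨e, he⟩
    rw [h i] at this
    simpa using this.symm
  simpa using congrArg Subtype.val this

/-- The vectors whose bracket with every vector lies in a given subspace. -/
def bracketPreimage (b : V →ₗ[F] V →ₗ[F] W) (W' : Submodule F W) : Submodule F V where
  carrier := {v | ∀ u, b v u ∈ W'}
  add_mem' hx hy u := by simpa using W'.add_mem (hx u) (hy u)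
  zero_mem' u := by simp
  smul_mem' c x hx u := by simpa using W'.smul_mem c (hx u)

theorem mem_bracketPreimage {b : V →ₗ[F] V →ₗ[F] W} {U : Submodule F W} {v : V} :
    v ∈ bracketPreimage b U ↔ ∀ u, b v u ∈ U := Iff.rfl

/-- The Jacobi identity for an alternating bracket `b` and an action `T`. -/
def IsJacobi (b : V →ₗ[F] V →ₗ[F] W) (T : W →ₗ[F] Module.Dual F V) : Prop :=
  ∀ x y z, T (b x y) z + T (b y z) x + T (b z x) y = 0

/-- Annihilation by the range of `T` costs its rank in conditions. The resulting symmetric form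
takes values in `W'.map T`, of dimension d, so it vanishes once it does on pairs from d separating
vectors, which costs (d+1 choose 2) more. -/
theorem rank_bracketPreimage_le [FiniteDimensional F W] {b : V →ₗ[F] V →ₗ[F] W}
    (hb : ∀ x y, b x y = -b y x) {T : W →ₗ[F] Module.Dual F V} (hT : IsJacobi b T)
    (W' : Submodule F W) {m : ℕ}
    (hm : Module.rank F (bracketPreimage b (W' ⊓ LinearMap.ker T)) ≤ m) :
    Module.rank F (bracketPreimage b W') ≤
      ((m + (Module.finrank F (LinearMap.range T) +
        (Module.finrank F (W'.map T) + 1).choose 2) : ℕ) : Cardinal) := by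
  classical
  have : Module.Free F (LinearMap.range T) := Module.Free.of_divisionRing F (LinearMap.range T)
  obtain ⟨x, hx⟩ := exists_separating_family (W'.map T)
  generalize Module.finrank F (W'.map T) = d at x hx ⊢
  let e := Module.finBasis F (LinearMap.range T)
  -- Unordered pairs suffice, with an arbitrary choice of order for each, because the form is
  -- symmetric on the kernel of the first block of conditions.
  let f : V →ₗ[F] (Fin (Module.finrank F (LinearMap.range T)) ⊕ Sym2 (Fin d)) → F :=
    LinearMap.pi (Sum.elim (fun i => (e i : Module.Dual F V))
      (fun q => (LinearMap.applyₗ (x (Quot.out q).2)).comp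
        (T.comp ((LinearMap.applyₗ (x (Quot.out q).1)).comp b))))
  let g := f.comp (bracketPreimage b W').subtype
  have hker : (LinearMap.ker g).map (bracketPreimage b W').subtype ≤
      bracketPreimage b (W' ⊓ LinearMap.ker T) := by
    rintro _ ⟨⟨v, hv⟩, hgv, rfl⟩
    have hgv' : f v = 0 := hgv
    have hv0 : ∀ w, T w v = 0 := by
      have h1 : ∀ i, (e i : Module.Dual F V) v = 0 := fun i => congrFun hgv' (Sum.inl i)
      intro w
      have h2 := congrArg (fun t : LinearMap.range T => (t : Module.Dual F V) v)
        (e.sum_repr ⟨T w, w, rfl⟩)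
      simp only [Submodule.coe_sum, Submodule.coe_smul, LinearMap.sum_apply, LinearMap.smul_apply,
        h1, smul_zero, Finset.sum_const_zero] at h2
      exact h2.symm
    have hsymm : ∀ u u', T (b v u) u' = T (b v u') u := by
      intro u u'
      have := hT v u u'
      rw [hv0, hb u' v, map_neg, LinearMap.neg_apply] at this
      linear_combination this
    have hxx : ∀ i j, T (b v (x i)) (x j) = 0 := by
      intro i j
      have h1 : T (b v (x (Quot.out s(i, j)).1)) (x (Quot.out s(i, j)).2) = 0 :=
        congrFun hgv' (Sum.inr s(i, j))
      have h2 : s((Quot.out s(i, j)).1, (Quot.out s(i, j)).2) = s(i, j) := Quot.out_eq s(i, j)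
      rcases Sym2.eq_iff.1 h2 with ⟨h3, h4⟩ | ⟨h3, h4⟩
      · rwa [h3, h4] at h1
      · rwa [h3, h4, hsymm] at h1
    have hD : ∀ u, T (b v u) ∈ W'.map T := fun u => ⟨_, hv u, rfl⟩
    -- Separation is used twice: first for the forms at the `x i`, then, through symmetry, for the
    -- form at any `u`.
    have hxu : ∀ i, T (b v (x i)) = 0 := fun i => hx _ (hD _) (hxx i)
    intro u
    refine ⟨hv u, hx _ (hD u) fun i => ?_⟩
    exact (hsymm u (x i)).trans (by rw [hxu, LinearMap.zero_apply])
  have hrk : Module.rank F (LinearMap.ker g) ≤ m := by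
    refine le_trans ?_ hm
    rw [(Submodule.equivMapOfInjective _ (Submodule.injective_subtype (bracketPreimage b W'))
      (LinearMap.ker g)).rank_eq]
    exact Submodule.rank_mono hker
  have := rank_le_of_rank_ker_le g hrk
  rwa [Fintype.card_sum, Fintype.card_fin, Sym2.card, Fintype.card_fin] at this

theorem finrank_map_add_finrank_inf_ker [FiniteDimensional F W] {U : Type*} [AddCommGroup U]
    [Module F U] (T : W →ₗ[F] U) (W' : Submodule F W) :
    Module.finrank F (W'.map T) + Module.finrank F (W' ⊓ LinearMap.ker T : Submodule F W) =
      Module.finrank F W' := by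
  have h := LinearMap.finrank_range_add_finrank_ker (T.domRestrict W')
  rw [LinearMap.range_domRestrict, LinearMap.ker_domRestrict] at h
  rw [← h]
  congr 1
  have := Submodule.finrank_map_subtype_eq W' ((LinearMap.ker T).comap W'.subtype)
  rw [Submodule.map_comap_subtype] at this
  exact this

theorem choose_two_add (m n : ℕ) :
    (m + n + 1).choose 2 = (m + 1).choose 2 + (n + 1).choose 2 + m * n := by
  induction n with
  | zero => simp
  | succ n ih =>
    rw [← add_assoc, Nat.choose_succ_succ' (m + n + 1), ih, Nat.choose_succ_succ' (n + 1)]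
    simp
    ring

/-- Some action is nonzero on a nonzero `W'`, so intersecting with its kernel lowers the dimension
by d ≥ 1. Each such step costs at most a + (d+1 choose 2), which the growth of the bound absorbs, as
a ≤ da and the cross term dm is nonnegative. -/
theorem rank_bracketPreimage_le_of_finrank [FiniteDimensional F W] {b : V →ₗ[F] V →ₗ[F] W}
    (hb : ∀ x y, b x y = -b y x) (hb0 : ∀ v, (∀ u, b v u = 0) → v = 0)
    (S : Set (W →ₗ[F] Module.Dual F V)) (hS : ∀ T ∈ S, IsJacobi b T)
    (hsep : ∀ w, (∀ T ∈ S, T w = 0) → w = 0) {a : ℕ}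
    (ha : ∀ T ∈ S, Module.finrank F (LinearMap.range T) ≤ a) (c : ℕ) :
    ∀ W' : Submodule F W, Module.finrank F W' = c →
      Module.rank F (bracketPreimage b W') ≤ ((c * a + (c + 1).choose 2 : ℕ) : Cardinal) := by
  induction c using Nat.strong_induction_on with
  | _ c ih =>
    intro W' hW'
    by_cases hbot : W' = ⊥
    · have : bracketPreimage b W' = ⊥ := by
        rw [eq_bot_iff]
        intro v hv
        refine hb0 v fun u => ?_
        simpa [hbot] using hv u
      rw [this]
      simp
    · obtain ⟨w, hw, hw0⟩ := Submodule.exists_mem_ne_zero_of_ne_bot hbot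
      obtain ⟨T, hTS, hTw⟩ : ∃ T ∈ S, T w ≠ 0 := by
        by_contra! h
        exact hw0 (hsep w h)
      have hdim := finrank_map_add_finrank_inf_ker T W'
      have hpos : 0 < Module.finrank F (W'.map T) := by
        by_contra! h0
        have h1 : W' ⊓ LinearMap.ker T = W' :=
          Submodule.eq_of_le_of_finrank_eq inf_le_left (by lia)
        exact hTw (h1.symm ▸ hw : w ∈ W' ⊓ LinearMap.ker T).2
      set d := Module.finrank F (W'.map T)
      set m := Module.finrank F (W' ⊓ LinearMap.ker T : Submodule F W)
      have hstep := rank_bracketPreimage_le hb (hS T hTS) W' (ih m (by lia) _ rfl)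
      refine hstep.trans ?_
      rw [Nat.cast_le, ← hW', ← hdim, choose_two_add]
      have := ha T hTS
      nlinarith [Nat.mul_le_mul_right a hpos, Nat.zero_le (d * m)]

/-- The rank bound for an alternating bracket on `V` with values in a `k`-dimensional space which
has trivial radical and admits a separating family of scalar-valued Jacobi actions; if the bound is
attained then a single action already separates. -/
theorem rank_le_of_separating_isJacobi [FiniteDimensional F W] {b : V →ₗ[F] V →ₗ[F] W}
    (hb : ∀ x y, b x y = -b y x) (hb0 : ∀ v, (∀ u, b v u = 0) → v = 0)
    (S : Set (W →ₗ[F] Module.Dual F V)) (hne : S.Nonempty) (hS : ∀ T ∈ S, IsJacobi b T)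
    (hsep : ∀ w, (∀ T ∈ S, T w = 0) → w = 0) {k : ℕ} (hk : Module.finrank F W = k) :
    Module.rank F V ≤ ((2 * k + k.choose 2 : ℕ) : Cardinal) ∧
      (Module.rank F V = ((2 * k + k.choose 2 : ℕ) : Cardinal) →
        ∃ T ∈ S, Function.Injective T) := by
  -- A `T` of maximal rank comes first: its rank then bounds the cost of every later step, taken
  -- inside its kernel.
  obtain ⟨T, hTS, hmax⟩ : ∃ T ∈ S, ∀ T' ∈ S, Module.finrank F (LinearMap.range T') ≤
      Module.finrank F (LinearMap.range T) := by
    have hbdd : BddAbove ((fun T : W →ₗ[F] Module.Dual F V =>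
        Module.finrank F (LinearMap.range T)) '' S) := by
      refine ⟨k, ?_⟩
      rintro _ ⟨T, -, rfl⟩
      exact hk ▸ LinearMap.finrank_range_le T
    obtain ⟨T, hTS, hT⟩ := Nat.sSup_mem (hne.image _) hbdd
    exact ⟨T, hTS, fun T' hT' => (le_csSup hbdd ⟨T', hT', rfl⟩).trans hT.ge⟩
  have hdim := LinearMap.finrank_range_add_finrank_ker T
  have hker := rank_bracketPreimage_le_of_finrank hb hb0 S hS hsep hmax _
    (⊤ ⊓ LinearMap.ker T) rfl
  have hstep := rank_bracketPreimage_le hb (hS T hTS) ⊤ hker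
  have htop : bracketPreimage b ⊤ = ⊤ := by
    ext v
    simp [mem_bracketPreimage]
  rw [htop, rank_top, Submodule.map_top, top_inf_eq] at hstep
  rw [hk] at hdim
  set a := Module.finrank F (LinearMap.range T)
  set c := Module.finrank F (LinearMap.ker T) with hc
  -- Since a + c = k, the cost is a + (k+1 choose 2), which falls short of the bound by exactly c,
  -- the dimension of the kernel of `T`.
  have hbound : c * a + (c + 1).choose 2 + (a + (a + 1).choose 2) + c = 2 * k + k.choose 2 := by
    have h1 : (k + 1).choose 2 = k + k.choose 2 := by
      rw [Nat.choose_succ_succ']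
      simp
    have h2 := choose_two_add a c
    rw [hdim] at h2
    nlinarith
  constructor
  · exact hstep.trans (Nat.cast_le.2 (by lia))
  · intro heq
    rw [heq, Nat.cast_le] at hstep
    refine ⟨T, hTS, ?_⟩
    rw [← LinearMap.ker_eq_bot, ← Submodule.finrank_eq_zero (R := F)]
    lia

end LinearAlgebra

/-! ### Descent of bimultiplicative maps to bilinear maps -/

section Descent

/-- A commutative group of exponent `p` is the additive group of a vector space over `ZMod p`. -/
theorem exists_module_zmod_of_pow_eq_one {A : Type u} [Group A] (p : ℕ)
    (hcomm : ∀ a b : A, a * b = b * a) (hexp : ∀ a : A, a ^ p = 1) :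
    ∃ (V : Type u) (_ : AddCommGroup V) (_ : Module (ZMod p) V),
      Nonempty (A ≃* Multiplicative V) := by
  let _ : CommGroup A := { ‹Group A› with mul_comm := hcomm }
  exact ⟨Additive A, inferInstance, AddCommGroup.zmodModule (n := p) fun x => hexp x.toMul,
    ⟨MulEquiv.refl A⟩⟩

variable {p : ℕ} {X Y A B M : Type*} [Group X] [Group Y] [AddCommGroup A] [AddCommGroup B]
  [AddCommGroup M] [Module (ZMod p) A] [Module (ZMod p) B] [Module (ZMod p) M]

/-- A map which is multiplicative in each variable descends to a bilinear map on vector space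
quotients. -/
theorem exists_bilinear_of_surjective (s : X →* Multiplicative A) (hs : Function.Surjective s)
    (t : Y →* Multiplicative B) (ht : Function.Surjective t) (f : X → Y → M)
    (hl : ∀ x x' y, f (x * x') y = f x y + f x' y) (hr : ∀ x y y', f x (y * y') = f x y + f x y')
    (hl0 : ∀ x, s x = 1 → ∀ y, f x y = 0) (hr0 : ∀ y, t y = 1 → ∀ x, f x y = 0) :
    ∃ β : A →ₗ[ZMod p] B →ₗ[ZMod p] M, ∀ x y, β (s x).toAdd (t y).toAdd = f x y := by
  have hl1 : ∀ x x' y, s x = s x' → f x y = f x' y := by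
    intro x x' y h
    have h1 := hl (x * x'⁻¹) x' y
    rwa [inv_mul_cancel_right, hl0 (x * x'⁻¹) (by simp [h]), zero_add] at h1
  have hr1 : ∀ x y y', t y = t y' → f x y = f x y' := by
    intro x y y' h
    have h1 := hr x (y * y'⁻¹) y'
    rwa [inv_mul_cancel_right, hr0 (y * y'⁻¹) (by simp [h]), zero_add] at h1
  let σ : A → X := fun a => Function.surjInv hs (Multiplicative.ofAdd a)
  let τ : B → Y := fun b => Function.surjInv ht (Multiplicative.ofAdd b)
  have hσ : ∀ a, s (σ a) = Multiplicative.ofAdd a := fun a => Function.surjInv_eq hs _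
  have hτ : ∀ b, t (τ b) = Multiplicative.ofAdd b := fun b => Function.surjInv_eq ht _
  let g : A → B →ₗ[ZMod p] M := fun a => AddMonoidHom.toZModLinearMap p
    (AddMonoidHom.mk' (fun b => f (σ a) (τ b)) fun b b' => by
      rw [← hr]
      exact hr1 _ _ _ (by rw [map_mul, hτ, hτ, hτ, ofAdd_add]))
  have hg : ∀ a b, g a b = f (σ a) (τ b) := fun _ _ => rfl
  refine ⟨AddMonoidHom.toZModLinearMap p (AddMonoidHom.mk' g fun a a' => ?_), fun x y => ?_⟩
  · ext b
    rw [LinearMap.add_apply, hg, hg, hg, ← hl]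
    exact hl1 _ _ _ (by rw [map_mul, hσ, hσ, hσ, ofAdd_add])
  · change f (σ _) (τ _) = _
    rw [hl1 _ x _ (by rw [hσ]; rfl), hr1 _ _ y (by rw [hτ]; rfl)]

end Descent

/-! ### Commutator calculus when H_3 is central -/

section ClassThree

variable {H : Type*} [Group H]

theorem commutatorElement_mul_left_of_mem_center {a b c : H} (h : ⁅b, c⁆ ∈ Subgroup.center H) :
    ⁅a * b, c⁆ = ⁅a, c⁆ * ⁅b, c⁆ := by
  rw [commutatorElement_mul_left_eq_conj_mul, Subgroup.mem_center_iff.1 h a,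
    mul_inv_cancel_right, Subgroup.mem_center_iff.1 h]

theorem commutatorElement_mul_right_of_mem_center {a b c : H} (h : ⁅a, c⁆ ∈ Subgroup.center H) :
    ⁅a, b * c⁆ = ⁅a, b⁆ * ⁅a, c⁆ := by
  have h1 : ⁅a, b * c⁆ = ⁅a, b⁆ * (b * ⁅a, c⁆ * b⁻¹) := by
    simp only [commutatorElement_def]
    group
  rw [h1, Subgroup.mem_center_iff.1 h b, mul_inv_cancel_right]

theorem commutatorElement_mem_commutator (x y : H) : ⁅x, y⁆ ∈ commutator H :=
  Subgroup.commutator_mem_commutator trivial trivial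

theorem commutatorElement_mem_lowerCentral {h : H} (hh : h ∈ commutator H) (x : H) :
    ⁅h, x⁆ ∈ ⁅commutator H, (⊤ : Subgroup H)⁆ :=
  Subgroup.commutator_mem_commutator hh trivial

/-- The derived subgroup centralizes the second centre. -/
theorem commutatorElement_eq_one_of_mem_commutator {h x : H} (hh : h ∈ commutator H)
    (hx : ∀ y, ⁅x, y⁆ ∈ Subgroup.center H) : ⁅h, x⁆ = 1 := by
  -- This is the second centre; the three subgroups lemma turns [[Z,H],H] = 1 into [[H,H],Z] = 1.
  let Z : Subgroup H := Subgroup.closure {x | ∀ y, ⁅x, y⁆ ∈ Subgroup.center H}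
  have hZ : ⁅⁅Z, (⊤ : Subgroup H)⁆, (⊤ : Subgroup H)⁆ = ⊥ := by
    rw [Subgroup.commutator_eq_bot_iff_le_centralizer, Subgroup.coe_top,
      Subgroup.centralizer_univ, Subgroup.commutator_le]
    intro z hz y _
    clear * - hz
    revert y
    refine Subgroup.closure_induction (fun x hx => hx) (fun y => ?_) (fun a b _ _ ha hb y => ?_)
      (fun a _ ha y => ?_) hz
    · rw [commutatorElement_one_left]
      exact one_mem _
    · rw [commutatorElement_mul_left_of_mem_center (hb y)]
      exact mul_mem (ha y) (hb y)
    · have h1 := commutatorElement_mul_left_of_mem_center (a := a⁻¹) (ha y)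
      rw [inv_mul_cancel, commutatorElement_one_left] at h1
      rw [eq_inv_of_mul_eq_one_left h1.symm]
      exact inv_mem (ha y)
  have h := Subgroup.commutator_commutator_eq_bot_of_rotate (H₁ := (⊤ : Subgroup H))
    (H₂ := (⊤ : Subgroup H)) (H₃ := Z) (by rw [Subgroup.commutator_comm ⊤ Z, hZ]) hZ
  have := Subgroup.commutator_mem_commutator hh (Subgroup.subset_closure hx : x ∈ Z)
  rwa [commutator_def, h, Subgroup.mem_bot] at this

variable {p : ℕ} {V W : Type*} [AddCommGroup V] [Module (ZMod p) V] [AddCommGroup W]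
  [Module (ZMod p) W]

/-- The commutator bracket of `H` modulo the second centre. -/
theorem exists_bracket
    (hcl : ⁅commutator H, (⊤ : Subgroup H)⁆ ≤ Subgroup.center H)
    (s : H →* Multiplicative V) (hs : Function.Surjective s)
    (hs1 : ∀ x, s x = 1 ↔ ∀ y, ⁅x, y⁆ ∈ Subgroup.center H)
    (t : commutator H →* Multiplicative W)
    (ht1 : ∀ h : commutator H, t h = 1 ↔ (h : H) ∈ Subgroup.center H) :
    ∃ b : V →ₗ[ZMod p] V →ₗ[ZMod p] W, ∀ x y, b (s x).toAdd (s y).toAdd =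
      (t ⟨⁅x, y⁆, commutatorElement_mem_commutator x y⟩).toAdd := by
  -- Conjugation moves elements of [H,H] only by central factors, which `t` ignores; hence the
  -- commutator becomes bimultiplicative after `t`.
  have hc : ∀ (x : H) (h : commutator H), ∃ z ∈ Subgroup.center H, x * h * x⁻¹ = z * h := by
    intro x h
    refine ⟨⁅x, (h : H)⁆, hcl ?_, by simp [commutatorElement_def]⟩
    rw [Subgroup.commutator_comm]
    exact Subgroup.commutator_mem_commutator trivial h.2
  have hconj : ∀ (x : H) (h : commutator H) (h' : x * h * x⁻¹ ∈ commutator H),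
      t ⟨x * h * x⁻¹, h'⟩ = t h := by
    intro x h h'
    rw [← mul_inv_eq_one, ← map_inv, ← map_mul, ht1]
    obtain ⟨z, hz, he⟩ := hc x h
    simpa [he] using hz
  refine exists_bilinear_of_surjective s hs s hs
    (fun x y => (t ⟨⁅x, y⁆, commutatorElement_mem_commutator x y⟩).toAdd) ?_ ?_ ?_ ?_
  · intro x x' y
    have h1 := commutatorElement_mul_left_eq_conj_mul x x' y
    have h2 : x * ⁅x', y⁆ * x⁻¹ ∈ commutator H :=
      Subgroup.Normal.conj_mem inferInstance _ (commutatorElement_mem_commutator x' y) _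
    have h3 := hconj x ⟨_, commutatorElement_mem_commutator x' y⟩ h2
    rw [add_comm, ← toAdd_mul, ← h3, ← map_mul]
    congr 2
    exact Subtype.ext h1
  · intro x y y'
    have h1 : ⁅x, y * y'⁆ = ⁅x, y⁆ * (y * ⁅x, y'⁆ * y⁻¹) := by
      simp only [commutatorElement_def]
      group
    have h2 : y * ⁅x, y'⁆ * y⁻¹ ∈ commutator H :=
      Subgroup.Normal.conj_mem inferInstance _ (commutatorElement_mem_commutator x y') _
    have h3 := hconj y ⟨_, commutatorElement_mem_commutator x y'⟩ h2
    rw [← toAdd_mul, ← h3, ← map_mul]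
    congr 2
    exact Subtype.ext h1
  · intro x hx y
    rw [toAdd_eq_zero, ht1]
    exact (hs1 x).1 hx y
  · intro y hy x
    rw [toAdd_eq_zero, ht1]
    change ⁅x, y⁆ ∈ _
    rw [← commutatorElement_inv]
    exact inv_mem ((hs1 y).1 hy x)

/-- A character of the third term of the lower central series turns the commutator into a pairing
of the derived subgroup with the group. -/
theorem exists_action
    (hcl : ⁅commutator H, (⊤ : Subgroup H)⁆ ≤ Subgroup.center H)
    (s : H →* Multiplicative V) (hs : Function.Surjective s)
    (hs1 : ∀ x, s x = 1 ↔ ∀ y, ⁅x, y⁆ ∈ Subgroup.center H)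
    (t : commutator H →* Multiplicative W) (ht : Function.Surjective t)
    (ht1 : ∀ h : commutator H, t h = 1 ↔ (h : H) ∈ Subgroup.center H)
    (φ : ↥⁅commutator H, (⊤ : Subgroup H)⁆ →* Multiplicative (ZMod p)) :
    ∃ T : W →ₗ[ZMod p] V →ₗ[ZMod p] ZMod p, ∀ (h : commutator H) (x : H),
      T (t h).toAdd (s x).toAdd =
        (φ ⟨⁅(h : H), x⁆, commutatorElement_mem_lowerCentral h.2 x⟩).toAdd := by
  refine exists_bilinear_of_surjective t ht s hs
    (fun h x => (φ ⟨⁅(h : H), x⁆, commutatorElement_mem_lowerCentral h.2 x⟩).toAdd) ?_ ?_ ?_ ?_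
  · intro h h' x
    rw [← toAdd_mul, ← map_mul]
    congr 2
    exact Subtype.ext (commutatorElement_mul_left_of_mem_center
      (hcl (commutatorElement_mem_lowerCentral h'.2 x)))
  · intro h x x'
    rw [← toAdd_mul, ← map_mul]
    congr 2
    exact Subtype.ext (commutatorElement_mul_right_of_mem_center
      (hcl (commutatorElement_mem_lowerCentral h.2 x')))
  · intro h hh x
    have h1 : ⁅(h : H), x⁆ = 1 := commutatorElement_eq_one_iff_mul_comm.2
      (Subgroup.mem_center_iff.1 ((ht1 h).1 hh) x).symm
    rw [toAdd_eq_zero, ← map_one φ]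
    congr 1
    exact Subtype.ext h1
  · intro x hx h
    rw [toAdd_eq_zero, ← map_one φ]
    congr 1
    exact Subtype.ext (commutatorElement_eq_one_of_mem_commutator h.2 ((hs1 x).1 hx))

/-- This is the Hall–Witt identity; its inner conjugations are invisible to `s`, whose target is
abelian. -/
theorem isJacobi_of_commutator (s : H →* Multiplicative V) (hs : Function.Surjective s)
    (t : commutator H →* Multiplicative W)
    {b : V →ₗ[ZMod p] V →ₗ[ZMod p] W}
    (hb : ∀ x y, b (s x).toAdd (s y).toAdd =
      (t ⟨⁅x, y⁆, commutatorElement_mem_commutator x y⟩).toAdd)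
    (φ : ↥⁅commutator H, (⊤ : Subgroup H)⁆ →* Multiplicative (ZMod p))
    {T : W →ₗ[ZMod p] V →ₗ[ZMod p] ZMod p}
    (hT : ∀ (h : commutator H) (x : H), T (t h).toAdd (s x).toAdd =
      (φ ⟨⁅(h : H), x⁆, commutatorElement_mem_lowerCentral h.2 x⟩).toAdd) (u v w : V) :
    T (b u v) w + T (b v w) u + T (b w u) v = 0 := by
  obtain ⟨x, hx⟩ := hs (Multiplicative.ofAdd u)
  obtain ⟨y, hy⟩ := hs (Multiplicative.ofAdd v)
  obtain ⟨z, hz⟩ := hs (Multiplicative.ofAdd w)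
  have hconj : ∀ x y : H, s (x * y * x⁻¹) = s y := by
    intro x y
    rw [map_mul, map_mul, map_inv, mul_comm (s x), mul_inv_cancel_right]
  have key : ∀ x y z : H, T (b (s x).toAdd (s y).toAdd) (s z).toAdd =
      (φ ⟨⁅⁅x, y⁆, y * z * y⁻¹⁆, commutatorElement_mem_lowerCentral
        (commutatorElement_mem_commutator x y) _⟩).toAdd := by
    intro x y z
    rw [hb, ← hconj y z, hT]
  have h1 := key x y z
  have h2 := key y z x
  have h3 := key z x y
  rw [hx, hy, hz] at h1 h2 h3
  simp only [toAdd_ofAdd] at h1 h2 h3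
  rw [h1, h2, h3, ← toAdd_mul, ← toAdd_mul, ← map_mul, ← map_mul, toAdd_eq_zero, ← map_one φ]
  congr 1
  exact Subtype.ext (commutatorElement_commutatorElement_conj_mul x y z)

end ClassThree

/-! ### Central extensions by bimultiplicative cocycles -/

/-- The central extension of `Q` by `A` defined by a bimultiplicative cocycle `β`. -/
@[ext]
structure TwistedProduct {Q A : Type*} [Group Q] [CommGroup A] (β : Q →* Q →* A) where
  /-- The component in the quotient. -/
  fst : Q
  /-- The component in the kernel. -/
  snd : A

namespace TwistedProduct

variable {Q A : Type*} [Group Q] [CommGroup A] {β : Q →* Q →* A}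

instance : Mul (TwistedProduct β) := ⟨fun k l => ⟨k.fst * l.fst, k.snd * l.snd * β k.fst l.fst⟩⟩

instance : One (TwistedProduct β) := ⟨⟨1, 1⟩⟩

instance : Inv (TwistedProduct β) := ⟨fun k => ⟨k.fst⁻¹, k.snd⁻¹ * β k.fst k.fst⟩⟩

@[simp] theorem mul_fst (k l : TwistedProduct β) : (k * l).fst = k.fst * l.fst := rfl

@[simp] theorem mul_snd (k l : TwistedProduct β) :
    (k * l).snd = k.snd * l.snd * β k.fst l.fst := rfl

@[simp] theorem one_fst : (1 : TwistedProduct β).fst = 1 := rfl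

@[simp] theorem one_snd : (1 : TwistedProduct β).snd = 1 := rfl

@[simp] theorem inv_fst (k : TwistedProduct β) : k⁻¹.fst = k.fst⁻¹ := rfl

@[simp] theorem inv_snd (k : TwistedProduct β) : k⁻¹.snd = k.snd⁻¹ * β k.fst k.fst := rfl

instance : Group (TwistedProduct β) :=
  Group.ofLeftAxioms
    (fun k l m => by
      ext
      · simp [mul_assoc]
      · simp only [mul_fst, mul_snd, map_mul, MonoidHom.mul_apply]
        simp only [mul_assoc, mul_left_comm, mul_comm])
    (fun k => by ext <;> simp)
    (fun k => by ext <;> simp)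

/-- The projection of a twisted product onto its quotient. -/
def fstHom (β : Q →* Q →* A) : TwistedProduct β →* Q where
  toFun := fst
  map_one' := rfl
  map_mul' _ _ := rfl

@[simp] theorem fstHom_apply (k : TwistedProduct β) : fstHom β k = k.fst := rfl

theorem fstHom_surjective (β : Q →* Q →* A) : Function.Surjective (fstHom β) :=
  fun q => ⟨⟨q, 1⟩, rfl⟩

theorem mem_center_iff {k : TwistedProduct β} :
    k ∈ Subgroup.center (TwistedProduct β) ↔
      k.fst ∈ Subgroup.center Q ∧ ∀ q, β q k.fst = β k.fst q := by
  simp only [Subgroup.mem_center_iff]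
  constructor
  · intro h
    refine ⟨fun q => congrArg fst (h ⟨q, 1⟩), fun q => ?_⟩
    simpa using congrArg snd (h ⟨q, 1⟩)
  · rintro ⟨h1, h2⟩ l
    ext
    · exact h1 l.fst
    · simp [h2, mul_comm]

/-- If the cocycle vanishes on the derived subgroup, then the third term of the lower central
series of the twisted product meets the kernel trivially. -/
theorem snd_eq_one_of_mem (hl : ∀ w ∈ commutator Q, ∀ q, β w q = 1)
    (hr : ∀ w ∈ commutator Q, ∀ q, β q w = 1) {k : TwistedProduct β}
    (hk : k ∈ ⁅commutator (TwistedProduct β), (⊤ : Subgroup (TwistedProduct β))⁆) :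
    k.snd = 1 := by
  let L : Subgroup (TwistedProduct β) :=
    { carrier := {k | k.fst ∈ commutator Q ∧ k.snd = 1}
      mul_mem' := fun {a b} ha hb => ⟨mul_mem ha.1 hb.1, by simp [ha.2, hb.2, hl _ ha.1]⟩
      one_mem' := ⟨one_mem _, rfl⟩
      inv_mem' := fun {a} ha => ⟨inv_mem ha.1, by simp [ha.2, hl _ ha.1]⟩ }
  have hfst : ∀ k ∈ commutator (TwistedProduct β), k.fst ∈ commutator Q := by
    intro k hk
    have h : (commutator (TwistedProduct β)).map (fstHom β) ≤ commutator Q := by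
      rw [commutator_def, commutator_def, Subgroup.map_commutator]
      exact Subgroup.commutator_mono le_top le_top
    exact h ⟨k, hk, rfl⟩
  suffices h : ⁅commutator (TwistedProduct β), (⊤ : Subgroup (TwistedProduct β))⁆ ≤ L from (h hk).2
  rw [Subgroup.commutator_le]
  intro k hk l _
  have hc := commutatorElement_mem_commutator k.fst l.fst
  -- All cocycle factors have an argument in the derived subgroup, so they vanish.
  have hkl : ⁅k, l⁆ = ⟨⁅k.fst, l.fst⁆, 1⟩ := by
    rw [commutatorElement_def, mul_inv_eq_iff_eq_mul, mul_inv_eq_iff_eq_mul]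
    ext
    · simp [commutatorElement_def]
    · simp only [mul_snd, mul_fst, map_mul, MonoidHom.mul_apply, hl _ hc, hl _ (hfst k hk),
        hr _ (hfst k hk), mul_one, one_mul, mul_comm k.snd]
  rw [hkl]
  exact ⟨hc, rfl⟩

end TwistedProduct

/-! ### Construction of a witness with cyclic third term -/

theorem isCapabilityWitness_of_surjective {G K : Type*} [Group G] [Group K] (ρ : K →* G)
    (hρ : Function.Surjective ρ) (hker : ρ.ker = Subgroup.center K) : IsCapabilityWitness G K :=
  ⟨(QuotientGroup.quotientMulEquivOfEq hker.symm).trans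
    (QuotientGroup.quotientKerEquivOfSurjective ρ hρ)⟩

theorem map_commutator_eq_of_surjective {H G : Type*} [Group H] [Group G] (π : H →* G)
    (hπ : Function.Surjective π) : (commutator H).map π = commutator G := by
  rw [commutator_def, commutator_def, Subgroup.map_commutator,
    Subgroup.map_top_of_surjective _ hπ]

theorem map_lowerCentralTerm_le {K Q : Type*} [Group K] [Group Q] (f : K →* Q) :
    ⁅commutator K, (⊤ : Subgroup K)⁆.map f ≤ ⁅commutator Q, (⊤ : Subgroup Q)⁆ := by
  rw [commutator_def, commutator_def, Subgroup.map_commutator, Subgroup.map_commutator]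
  exact Subgroup.commutator_mono (Subgroup.commutator_mono le_top le_top) le_top

/-- Killing the kernel of a cyclic character of `[[H, H], H]` makes the third term of the lower
central series cyclic. -/
theorem isCyclic_lowerCentral_quotient {H M : Type*} [Group H] [Group M] [IsCyclic M]
    (φ : ↥⁅commutator H, (⊤ : Subgroup H)⁆ →* M) (N : Subgroup H) [N.Normal]
    (hN : ∀ h : ↥⁅commutator H, (⊤ : Subgroup H)⁆, φ h = 1 → (h : H) ∈ N) :
    IsCyclic ↥⁅commutator (H ⧸ N), (⊤ : Subgroup (H ⧸ N))⁆ := by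
  have : IsCyclic (↥⁅commutator H, (⊤ : Subgroup H)⁆ ⧸ φ.ker) :=
    isCyclic_of_injective (QuotientGroup.kerLift φ) (QuotientGroup.kerLift_injective φ)
  let f : ↥⁅commutator H, (⊤ : Subgroup H)⁆ →* ↥⁅commutator (H ⧸ N), (⊤ : Subgroup (H ⧸ N))⁆ :=
    ((QuotientGroup.mk' N).comp (Subgroup.subtype _)).codRestrict _
      fun h => map_lowerCentralTerm_le (QuotientGroup.mk' N) ⟨h, h.2, rfl⟩
  have hf : Function.Surjective f := by
    rintro ⟨q, hq⟩
    have hmap : ⁅commutator H, (⊤ : Subgroup H)⁆.map (QuotientGroup.mk' N) =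
        ⁅commutator (H ⧸ N), (⊤ : Subgroup (H ⧸ N))⁆ := by
      rw [commutator_def, commutator_def, Subgroup.map_commutator, Subgroup.map_commutator,
        Subgroup.map_top_of_surjective _ (QuotientGroup.mk'_surjective N)]
    rw [← hmap] at hq
    obtain ⟨h, hh, rfl⟩ := hq
    exact ⟨⟨h, hh⟩, rfl⟩
  refine isCyclic_of_surjective (QuotientGroup.lift φ.ker f fun h hh => ?_)
    (QuotientGroup.lift_surjective_of_surjective _ _ hf _)
  exact Subtype.ext ((QuotientGroup.eq_one_iff _).2 (hN h hh))

/-- If a character `φ` of `[[H, H], H]` detects the non-central elements of the derived subgroup of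
a witness `H`, then there is a witness whose third lower central term is cyclic. -/
theorem exists_witness_isCyclic {p : ℕ} [Fact p.Prime] {G H : Type u} [Group G] [Group H]
    (π : H →* G) (hπ : Function.Surjective π) (hker : π.ker = Subgroup.center H)
    (hG : commutator G ≤ Subgroup.center G) (hexp : ∀ g : G, g ^ p = 1)
    (χ : G →* Multiplicative (ZMod p)) (hχ : ∀ g ∈ Subgroup.center G, χ g = 1)
    (hχ1 : ∃ g, χ g ≠ 1)
    (hcl : ⁅commutator H, (⊤ : Subgroup H)⁆ ≤ Subgroup.center H)
    (φ : ↥⁅commutator H, (⊤ : Subgroup H)⁆ →* Multiplicative (ZMod p))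
    (hφ : ∀ h : commutator H, (∀ x, φ ⟨⁅(h : H), x⁆, commutatorElement_mem_lowerCentral h.2 x⟩ = 1) →
      (h : H) ∈ Subgroup.center H) :
    ∃ (K : Type u) (_ : Group K), IsCapabilityWitness G K ∧ IsCyclic (lowerCentralTerm K 3) := by
  let N : Subgroup H := φ.ker.map (Subgroup.subtype _)
  have hNφ : ∀ h : ↥⁅commutator H, (⊤ : Subgroup H)⁆, (h : H) ∈ N ↔ φ h = 1 := by
    intro h
    constructor
    · rintro ⟨h', hh', he⟩
      rwa [← Subtype.ext he]
    · exact fun hh => ⟨h, hh, rfl⟩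
  have hNcl : N ≤ ⁅commutator H, (⊤ : Subgroup H)⁆ := by
    rintro _ ⟨h, -, rfl⟩
    exact h.2
  have hNc : N ≤ Subgroup.center H := hNcl.trans hcl
  have : N.Normal := ⟨fun n hn g => by
    rwa [Subgroup.mem_center_iff.1 (hNc hn) g, mul_inv_cancel_right]⟩
  let ρ : H ⧸ N →* G := QuotientGroup.lift N π fun n hn => hker.ge (hNc hn)
  have hρ : Function.Surjective ρ := QuotientGroup.lift_surjective_of_surjective _ _ hπ _
  obtain ⟨C, _, _, ⟨e⟩⟩ := exists_module_zmod_of_pow_eq_one (A := Abelianization G) p mul_comm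
    (fun a => by
      obtain ⟨g, rfl⟩ := QuotientGroup.mk_surjective a
      exact congrArg Abelianization.of (hexp g))
  let c : G →* Multiplicative C := e.toMonoidHom.comp Abelianization.of
  have hc : ∀ g, c g = 1 ↔ g ∈ commutator G := by
    intro g
    rw [← Abelianization.ker_of, MonoidHom.mem_ker]
    exact e.map_eq_one_iff
  -- The asymmetry is deliberate: for central g the factor χ(g) vanishes, so β(q,g) = β(g,q) reads
  -- χ(q)c(g) = 0. As χ ≠ 1, this forces g into [G,G].
  let βG : G →* G →* Multiplicative C := MonoidHom.mk'
    (fun g => MonoidHom.mk' (fun g' => Multiplicative.ofAdd ((χ g).toAdd • (c g').toAdd))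
      fun a b => by rw [map_mul, toAdd_mul, smul_add, ofAdd_add])
    fun a b => by
      ext g
      simp [add_smul]
  have hβG : ∀ g g', βG g g' = Multiplicative.ofAdd ((χ g).toAdd • (c g').toAdd) := fun _ _ => rfl
  let β : (H ⧸ N) →* (H ⧸ N) →* Multiplicative C := (MonoidHom.compHom' ρ).comp (βG.comp ρ)
  have hβ : ∀ x y, β x y = βG (ρ x) (ρ y) := fun _ _ => rfl
  have hρc : ∀ w ∈ commutator (H ⧸ N), ρ w ∈ commutator G := by
    intro w hw
    have h : (commutator (H ⧸ N)).map ρ ≤ commutator G := by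
      rw [commutator_def, commutator_def, Subgroup.map_commutator]
      exact Subgroup.commutator_mono le_top le_top
    exact h ⟨w, hw, rfl⟩
  have hl : ∀ w ∈ commutator (H ⧸ N), ∀ q, β w q = 1 := by
    intro w hw q
    rw [hβ, hβG, hχ _ (hG (hρc w hw))]
    simp
  have hr : ∀ w ∈ commutator (H ⧸ N), ∀ q, β q w = 1 := by
    intro w hw q
    rw [hβ, hβG, (hc _).2 (hρc w hw)]
    simp
  refine ⟨TwistedProduct β, inferInstance, isCapabilityWitness_of_surjective
    (ρ.comp (TwistedProduct.fstHom β)) (hρ.comp (TwistedProduct.fstHom_surjective β)) ?_, ?_⟩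
  · ext ⟨q, a⟩
    obtain ⟨h, rfl⟩ := QuotientGroup.mk_surjective q
    rw [MonoidHom.mem_ker, TwistedProduct.mem_center_iff]
    change π h = 1 ↔ (h : H ⧸ N) ∈ _ ∧ ∀ q, β q (h : H ⧸ N) = β (h : H ⧸ N) q
    constructor
    · intro hh
      have hh' : h ∈ Subgroup.center H := hker.le hh
      refine ⟨?_, fun q => ?_⟩
      · rw [Subgroup.mem_center_iff]
        intro q
        obtain ⟨x, rfl⟩ := QuotientGroup.mk_surjective q
        rw [← QuotientGroup.mk_mul, ← QuotientGroup.mk_mul, Subgroup.mem_center_iff.1 hh']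
      · have h1 : ρ (h : H ⧸ N) = 1 := hh
        rw [hβ, hβ, h1, map_one, map_one, MonoidHom.one_apply]
    · rintro ⟨hh1, hh2⟩
      have hhN : ∀ x, ⁅h, x⁆ ∈ N := by
        intro x
        rw [← QuotientGroup.eq_one_iff]
        exact commutatorElement_eq_one_iff_mul_comm.2
          (Subgroup.mem_center_iff.1 hh1 (x : H ⧸ N)).symm
      have hcen : π h ∈ Subgroup.center G := by
        rw [Subgroup.mem_center_iff]
        intro g
        obtain ⟨x, rfl⟩ := hπ g
        have h1 : π ⁅h, x⁆ = 1 := hker.ge (hNc (hhN x))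
        rw [map_commutatorElement] at h1
        exact (commutatorElement_eq_one_iff_mul_comm.1 h1).symm
      have hcomm : π h ∈ commutator G := by
        rw [← hc]
        obtain ⟨g, hg⟩ := hχ1
        obtain ⟨q, rfl⟩ := hρ g
        have h1 := hh2 q
        rw [hβ, hβ, hβG, hβG] at h1
        have h2 : ρ (h : H ⧸ N) = π h := rfl
        rw [h2, hχ _ hcen, toAdd_one, zero_smul, ofAdd_zero, ofAdd_eq_one, smul_eq_zero] at h1
        exact h1.resolve_left hg
      -- A lift h' in [H,H] of π h differs from h by a central element, so its commutators also lie
      -- in the kernel of `φ`, and `hφ` applies.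
      rw [← map_commutator_eq_of_surjective π hπ] at hcomm
      obtain ⟨h', hh', he⟩ := hcomm
      have hz : h'⁻¹ * h ∈ Subgroup.center H := hker.le (by simp [MonoidHom.mem_ker, he])
      have h1 : h' ∈ Subgroup.center H := by
        refine hφ ⟨h', hh'⟩ fun x => ?_
        rw [← hNφ]
        change ⁅h', x⁆ ∈ N
        have h2 : ⁅h'⁻¹ * h, x⁆ = 1 := commutatorElement_eq_one_iff_mul_comm.2
          (Subgroup.mem_center_iff.1 hz x).symm
        have h3 := commutatorElement_mul_left_of_mem_center (a := h') (b := h'⁻¹ * h) (c := x)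
          (h2 ▸ one_mem _)
        rw [mul_inv_cancel_left, h2, mul_one] at h3
        exact h3 ▸ hhN x
      rw [← he]
      exact hker.ge h1
  · have hcyc := isCyclic_lowerCentral_quotient φ N fun h hh => (hNφ h).2 hh
    let f : ↥⁅commutator (TwistedProduct β), (⊤ : Subgroup (TwistedProduct β))⁆ →*
        ↥⁅commutator (H ⧸ N), (⊤ : Subgroup (H ⧸ N))⁆ :=
      ((TwistedProduct.fstHom β).comp (Subgroup.subtype _)).codRestrict _
        fun k => map_lowerCentralTerm_le (TwistedProduct.fstHom β) ⟨k, k.2, rfl⟩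
    refine isCyclic_of_injective f fun k l hkl => Subtype.ext (TwistedProduct.ext ?_ ?_)
    · exact congrArg Subtype.val hkl
    · rw [TwistedProduct.snd_eq_one_of_mem hl hr k.2, TwistedProduct.snd_eq_one_of_mem hl hr l.2]

/-- In a group of class at most three whose derived subgroup has exponent `p` modulo the centre,
the third term of the lower central series has exponent `p`. -/
theorem pow_eq_one_of_mem_lowerCentral {H : Type*} [Group H] {p : ℕ}
    (hcl : ⁅commutator H, (⊤ : Subgroup H)⁆ ≤ Subgroup.center H)
    (hp : ∀ h ∈ commutator H, h ^ p ∈ Subgroup.center H) {z : H}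
    (hz : z ∈ ⁅commutator H, (⊤ : Subgroup H)⁆) : z ^ p = 1 := by
  let L : Subgroup H :=
    { carrier := {z | z ∈ Subgroup.center H ∧ z ^ p = 1}
      mul_mem' := fun {a b} ha hb => ⟨mul_mem ha.1 hb.1, by
        rw [Commute.mul_pow (Subgroup.mem_center_iff.1 hb.1 a), ha.2, hb.2, one_mul]⟩
      one_mem' := ⟨one_mem _, one_pow p⟩
      inv_mem' := fun {a} ha => ⟨inv_mem ha.1, by rw [inv_pow, ha.2, inv_one]⟩ }
  suffices h : ⁅commutator H, (⊤ : Subgroup H)⁆ ≤ L from (h hz).2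
  rw [Subgroup.commutator_le]
  intro h hh x _
  have hc : ⁅h, x⁆ ∈ Subgroup.center H := hcl (commutatorElement_mem_lowerCentral hh x)
  -- Hence [h,x]^p = [h^p,x], which is trivial because h^p is central.
  have hpow : ∀ n : ℕ, ⁅h ^ n, x⁆ = ⁅h, x⁆ ^ n := by
    intro n
    induction n with
    | zero => simp
    | succ n ih => rw [pow_succ, commutatorElement_mul_left_of_mem_center hc, ih, pow_succ]
  refine ⟨hc, ?_⟩
  rw [← hpow]
  exact commutatorElement_eq_one_iff_mul_comm.2 (Subgroup.mem_center_iff.1 (hp h hh) x).symm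

theorem mainTheorem4 (p : ℕ) (hp : p.Prime) (G : Type u) [Group G]
    (hexp : ∀ g : G, g ^ p = 1) (hclass : lowerCentralTerm G 3 = ⊥) (hcap : IsCapable G)
    (k : ℕ) (hk : IsElementaryAbelianOfRank p (commutator G) k) :
    ∃ r : ℕ, IsElementaryAbelianOfRank p (G ⧸ Subgroup.center G) r ∧
      r ≤ 2 * k + k.choose 2 ∧
      (r = 2 * k + k.choose 2 →
        ∃ (H : Type u) (_ : Group H), IsCapabilityWitness G H ∧ IsCyclic (lowerCentralTerm H 3)) := by
  have : Fact p.Prime := ⟨hp⟩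
  obtain ⟨H, _, ⟨e⟩⟩ := hcap
  obtain ⟨eW⟩ := hk
  let π : H →* G := e.toMonoidHom.comp (QuotientGroup.mk' (Subgroup.center H))
  have hπ : Function.Surjective π := e.surjective.comp (QuotientGroup.mk'_surjective _)
  have hker : π.ker = Subgroup.center H := by
    ext h
    rw [MonoidHom.mem_ker]
    exact e.map_eq_one_iff.trans (QuotientGroup.eq_one_iff h)
  have hclass' : ⁅commutator G, (⊤ : Subgroup G)⁆ = ⊥ := hclass
  have hG : commutator G ≤ Subgroup.center G := by
    rwa [Subgroup.commutator_eq_bot_iff_le_centralizer, Subgroup.coe_top,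
      Subgroup.centralizer_univ] at hclass'
  have hcl : ⁅commutator H, (⊤ : Subgroup H)⁆ ≤ Subgroup.center H := by
    intro h hh
    have h1 := map_lowerCentralTerm_le π ⟨h, hh, rfl⟩
    rw [hclass'] at h1
    exact hker.le h1
  obtain ⟨V, _, _, ⟨eV⟩⟩ := exists_module_zmod_of_pow_eq_one (A := G ⧸ Subgroup.center G) p
    (fun a b => by
      obtain ⟨x, rfl⟩ := QuotientGroup.mk_surjective a
      obtain ⟨y, rfl⟩ := QuotientGroup.mk_surjective b
      exact commutatorElement_eq_one_iff_mul_comm.1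
        ((QuotientGroup.eq_one_iff ⁅x, y⁆).2 (hG (commutatorElement_mem_commutator x y))))
    (fun a => by
      obtain ⟨x, rfl⟩ := QuotientGroup.mk_surjective a
      rw [← QuotientGroup.mk_pow, hexp, QuotientGroup.mk_one])
  let sG : G →* Multiplicative V := eV.toMonoidHom.comp (QuotientGroup.mk' _)
  have hsG : Function.Surjective sG := eV.surjective.comp (QuotientGroup.mk'_surjective _)
  have hsG1 : ∀ g, sG g = 1 ↔ g ∈ Subgroup.center G := fun g =>
    eV.map_eq_one_iff.trans (QuotientGroup.eq_one_iff g)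
  have hs : Function.Surjective (sG.comp π) := hsG.comp hπ
  have hs1 : ∀ x, sG.comp π x = 1 ↔ ∀ y, ⁅x, y⁆ ∈ Subgroup.center H := by
    intro x
    rw [MonoidHom.comp_apply, hsG1, Subgroup.mem_center_iff, hπ.forall]
    refine forall_congr' fun y => ?_
    rw [← hker, MonoidHom.mem_ker, map_commutatorElement, commutatorElement_eq_one_iff_mul_comm,
      eq_comm]
  have hmap := map_commutator_eq_of_surjective π hπ
  let t : commutator H →* Multiplicative (Fin k → ZMod p) := eW.toMonoidHom.comp
    ((π.comp (Subgroup.subtype _)).codRestrict (commutator G) fun h => hmap.le ⟨h, h.2, rfl⟩)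
  have ht : Function.Surjective t := by
    refine eW.surjective.comp ?_
    rintro ⟨g, hg⟩
    rw [← hmap] at hg
    obtain ⟨h, hh, rfl⟩ := hg
    exact ⟨⟨h, hh⟩, rfl⟩
  have ht1 : ∀ h : commutator H, t h = 1 ↔ (h : H) ∈ Subgroup.center H := by
    intro h
    rw [← hker, MonoidHom.mem_ker]
    exact eW.map_eq_one_iff.trans Subtype.ext_iff
  obtain ⟨b, hb⟩ := exists_bracket (p := p) hcl (sG.comp π) hs hs1 t ht1
  obtain ⟨U, _, _, ⟨eU⟩⟩ := exists_module_zmod_of_pow_eq_one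
    (A := ↥⁅commutator H, (⊤ : Subgroup H)⁆) p
    (fun a c => Subtype.ext (Subgroup.mem_center_iff.1 (hcl c.2) a))
    (fun a => Subtype.ext (pow_eq_one_of_mem_lowerCentral hcl
      (fun h _ => hker.le (by rw [MonoidHom.mem_ker, map_pow, hexp])) a.2))
  have hsep : ∀ z : ↥⁅commutator H, (⊤ : Subgroup H)⁆, z ≠ 1 →
      ∃ φ : ↥⁅commutator H, (⊤ : Subgroup H)⁆ →* Multiplicative (ZMod p), φ z ≠ 1 := by
    intro z hz
    by_contra! h
    refine hz (eU.map_eq_one_iff.1 ?_)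
    rw [← toAdd_eq_zero, ← Module.forall_dual_apply_eq_zero_iff (ZMod p)]
    intro ψ
    exact h ((AddMonoidHom.toMultiplicative ψ.toAddMonoidHom).comp eU.toMonoidHom)
  let S : Set ((Fin k → ZMod p) →ₗ[ZMod p] V →ₗ[ZMod p] ZMod p) :=
    {T | ∃ φ : ↥⁅commutator H, (⊤ : Subgroup H)⁆ →* Multiplicative (ZMod p),
      ∀ (h : commutator H) (x : H), T (t h).toAdd (sG.comp π x).toAdd =
        (φ ⟨⁅(h : H), x⁆, commutatorElement_mem_lowerCentral h.2 x⟩).toAdd}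
  have hact := exists_action (p := p) hcl (sG.comp π) hs hs1 t ht ht1
  have hmain := rank_le_of_separating_isJacobi (b := b) ?_ ?_ S ?_ ?_ ?_
    (Module.finrank_fin_fun (ZMod p) (n := k))
  · obtain ⟨hle, heq⟩ := hmain
    have hfin : Module.Finite (ZMod p) V :=
      Module.rank_lt_aleph0_iff.1 (hle.trans_lt Cardinal.natCast_lt_aleph0)
    rw [← Module.finrank_eq_rank] at hle heq
    refine ⟨Module.finrank (ZMod p) V,
      ⟨eV.trans (AddEquiv.toMultiplicative (Module.finBasis (ZMod p) V).equivFun.toAddEquiv)⟩,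
      Nat.cast_le.1 hle, fun hr => ?_⟩
    -- For abelian G no nontrivial χ kills the centre, but then H has class at most 2 and serves
    -- itself.
    by_cases hab : ∀ g : G, g ∈ Subgroup.center G
    · refine ⟨H, _, ⟨e⟩, ?_⟩
      have hcomm : commutator H ≤ Subgroup.center H := by
        rw [commutator_def, Subgroup.commutator_le]
        exact fun x _ y _ => (hs1 x).1 ((hsG1 _).2 (hab _)) y
      have hbot : lowerCentralTerm H 3 = ⊥ := by
        change ⁅commutator H, (⊤ : Subgroup H)⁆ = ⊥
        rwa [Subgroup.commutator_eq_bot_iff_le_centralizer, Subgroup.coe_top,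
          Subgroup.centralizer_univ]
      rw [hbot]
      infer_instance
    · push Not at hab
      obtain ⟨g, hg⟩ := hab
      obtain ⟨ψ, hψ⟩ : ∃ ψ : Module.Dual (ZMod p) V, ψ (sG g).toAdd ≠ 0 := by
        by_contra! h
        rw [Module.forall_dual_apply_eq_zero_iff, toAdd_eq_zero, hsG1] at h
        exact hg h
      obtain ⟨T, ⟨φ, hφ⟩, hT⟩ := heq (by rw [hr])
      refine exists_witness_isCyclic π hπ hker hG hexp
        ((AddMonoidHom.toMultiplicative ψ.toAddMonoidHom).comp sG) ?_ ⟨g, hψ⟩ hcl φ ?_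
      · intro g hg
        rw [MonoidHom.comp_apply, (hsG1 g).2 hg, map_one]
      · intro h hh
        rw [← ht1, ← toAdd_eq_zero]
        apply hT
        rw [map_zero]
        ext v
        obtain ⟨x, hx⟩ := hs (Multiplicative.ofAdd v)
        have h1 := hφ h x
        rwa [hh, hx] at h1
  · intro u v
    obtain ⟨x, hx⟩ := hs (Multiplicative.ofAdd u)
    obtain ⟨y, hy⟩ := hs (Multiplicative.ofAdd v)
    have h1 := hb x y
    have h2 := hb y x
    rw [hx, hy] at h1 h2
    rw [toAdd_ofAdd, toAdd_ofAdd] at h1 h2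
    rw [h1, h2, ← toAdd_inv, ← map_inv]
    congr 2
    exact Subtype.ext (commutatorElement_inv y x).symm
  · intro v hv
    obtain ⟨x, hx⟩ := hs (Multiplicative.ofAdd v)
    have h1 : sG.comp π x = 1 := by
      rw [hs1]
      intro y
      have h2 := hb x y
      rw [hx, toAdd_ofAdd, hv] at h2
      exact (ht1 ⟨⁅x, y⁆, commutatorElement_mem_commutator x y⟩).1 (toAdd_eq_zero.1 h2.symm)
    rw [hx] at h1
    exact ofAdd_eq_one.1 h1
  -- The trivial character shows that `S` is nonempty even when H_3 is trivial.
  · obtain ⟨T, hT⟩ := hact 1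
    exact ⟨T, 1, hT⟩
  · rintro T ⟨φ, hφ⟩ u v w
    exact isJacobi_of_commutator (sG.comp π) hs t hb φ hφ u v w
  · intro w hw
    obtain ⟨h, hh⟩ := ht (Multiplicative.ofAdd w)
    rw [← ofAdd_eq_one, ← hh, ht1, Subgroup.mem_center_iff]
    intro x
    by_contra hne
    have hne' : ⁅(h : H), x⁆ ≠ 1 := fun h1 =>
      hne (commutatorElement_eq_one_iff_mul_comm.1 h1).symm
    obtain ⟨φ, hφ⟩ := hsep ⟨⁅(h : H), x⁆, commutatorElement_mem_lowerCentral h.2 x⟩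
      fun h1 => hne' (congrArg Subtype.val h1)
    obtain ⟨T, hT⟩ := hact φ
    have h1 := hT h x
    rw [hh, toAdd_ofAdd, hw T ⟨φ, hT⟩, LinearMap.zero_apply] at h1
    exact hφ (toAdd_eq_zero.1 h1.symm)
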